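/- Let $\mathcal A$ be a finite set. A $\mathbb Z^2$-subshift $X\subset\mathcal A^{\mathbb Z^2}$ is a closed set invariant under the shifts $(T^ux)(v)=x(u+v)$, $u\in\mathbb Z^2$. Let $P\subset\mathbb R^2$ be a convex polygon with nonempty interior and vertices in $\mathbb Z^2$, its edges carrying the induced boundary orientation. Two oriented edges are antiparallel if the direction vector of one is a negative multiple of the direction vector of the other. A subshift $X$ is polygonal with respect to $P$ if $X$ is infinite and, for every vertex $v$ of $P$, any two elements of $X$ that agree on $(P\setminus\{v\})\cap\mathbb Z^2$ also agree at $v$. For $S\subset\mathbb R^2$ bounded let $N(X,S)$ be the number of restrictions to $S\cap\mathbb Z^2$ of elements of $X$, and let $S_r$ be the set of points at Euclidean distance less than $r$ from $S$. For $v\in\mathbb R^2$ put $I_v=\{tv: 0\le t\le 1\}$ and let $$h_v(X)=\lim_{r\to\infty}\limsup_{n\to\infty}\frac{\ln N(X,(nI_v)_r)}{n}\in[0,\infty]$$ be the directional entropy. The entropy seminorm $\|v\|_X=h_v(X)$ is nontrivial if it does not vanish identically. Proposition 6.9. Suppose that $P$ has no two antiparallel edges. Then there is a constant $D>0$, depending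 only on $P$, such that for every $\mathbb Z^2$-subshift $X$ (over any finite alphabet) that is polygonal with respect to $P$ and has nontrivial entropy seminorm, one has $0<h_v(X)<\infty$ for every unit vector $v\in\mathbb R^2$, and $$\frac1D\le\frac{h_u(X)}{h_v(X)}\le D$$ for all unit vectors $u,v\in\mathbb R^2$. -/

import Mathlib

noncomputable section

namespace PolygonalShift

open Filter
open scoped Pointwise

/-- The Euclidean plane `ℝ²`. -/
abbrev Plane : Type := EuclideanSpace ℝ (Fin 2)

/-- The inclusion of the lattice `ℤ²` in the plane. -/
def toPlane (z : ℤ × ℤ) : Plane := !₂[(z.1 : ℝ), (z.2 : ℝ)]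

/-- The integer points of a subset of the plane. -/
def latticePoints (S : Set Plane) : Set (ℤ × ℤ) := {z | toPlane z ∈ S}

/-- A `ℤ²`-subshift over the (finite, discrete) alphabet `A`: a closed subset of `A ^ ℤ²`
(product topology) invariant under all the shifts `(T ^ u x) v = x (u + v)`. -/
structure Subshift (A : Type*) [TopologicalSpace A] where
  carrier : Set (ℤ × ℤ → A)
  isClosed : IsClosed carrier
  shift_mem : ∀ u : ℤ × ℤ, ∀ x ∈ carrier, (fun v => x (u + v)) ∈ carrier

/-- `R` `X`-codes `S`: any two elements of `X` that agree on the integer points of `R` agree on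
the integer points of `S`. -/
def Codes {A : Type*} [TopologicalSpace A] (X : Subshift A) (R S : Set Plane) : Prop :=
  ∀ x ∈ X.carrier, ∀ y ∈ X.carrier,
    Set.EqOn x y (latticePoints R) → Set.EqOn x y (latticePoints S)

/-- The cross product (signed area) of two integer vectors. -/
def cross (a b : ℤ × ℤ) : ℤ := a.1 * b.2 - a.2 * b.1

/-- A (nondegenerate) convex integer polygon, given by its `n ≥ 3` vertices in counterclockwise
order: every vertex other than the endpoints `vertex i`, `vertex (i + 1)` (indices mod `n`) of an
oriented edge lies strictly to the left of that edge. -/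
structure ConvexIntegerPolygon where
  n : ℕ
  three_le : 3 ≤ n
  vertex : Fin n → ℤ × ℤ
  left_of_edge : ∀ i j : Fin n, j ≠ i → j ≠ finRotate n i →
    0 < cross (vertex (finRotate n i) - vertex i) (vertex j - vertex i)

/-- The closed convex region bounded by the polygon. -/
def ConvexIntegerPolygon.region (P : ConvexIntegerPolygon) : Set Plane :=
  convexHull ℝ (Set.range fun i => toPlane (P.vertex i))

/-- The direction vector of the `i`-th edge, with the orientation induced from the polygon. -/
def ConvexIntegerPolygon.edge (P : ConvexIntegerPolygon) (i : Fin P.n) : Plane :=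
  toPlane (P.vertex (finRotate P.n i)) - toPlane (P.vertex i)

/-- Two (nonzero) direction vectors are antiparallel if one is a positive multiple of the
negative of the other. -/
def Antiparallel (e f : Plane) : Prop := ∃ c : ℝ, 0 < c ∧ f = c • (-e)

/-- No two oriented edges of the polygon are antiparallel. -/
def ConvexIntegerPolygon.NoAntiparallelSides (P : ConvexIntegerPolygon) : Prop :=
  ∀ i j : Fin P.n, ¬ Antiparallel (P.edge i) (P.edge j)

/-- `X` is polygonal with respect to `P`: `X` is infinite and, for every vertex `v` of `P`, the set
`P \ {v}` `X`-codes `v`. -/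
def IsPolygonal {A : Type*} [TopologicalSpace A] (X : Subshift A)
    (P : ConvexIntegerPolygon) : Prop :=
  X.carrier.Infinite ∧
    ∀ i : Fin P.n, Codes X (P.region \ {toPlane (P.vertex i)}) {toPlane (P.vertex i)}

/-- The complexity `P(X, S)`: the number of restrictions to `S ∩ ℤ²` of elements of `X`
(only used for bounded sets `S`, where this number is finite if the alphabet is finite). -/
def complexity {A : Type*} [TopologicalSpace A] (X : Subshift A) (S : Set Plane) : ℕ :=
  ((latticePoints S).domRestrict '' X.carrier).ncard

/-- The linear entropy `lim_{r → ∞} lim_{n → ∞} (ln P(X, (n S)_r)) / n` of a bounded set `S`, as an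
extended nonnegative real, where `(n S)_r` is the open Euclidean `r`-neighbourhood of `n S`.
The inner limit is read as an upper limit. The upper limit over `r` is a limit, because the
function of `r` is monotone. -/
def linearEntropy {A : Type*} [TopologicalSpace A] (X : Subshift A) (S : Set Plane) : ENNReal :=
  limsup (fun r : ℝ => limsup (fun n : ℕ =>
    ENNReal.ofReal (Real.log (complexity X (Metric.thickening r ((n : ℝ) • S))) / n))
      atTop) atTop

/-- The directional entropy `h_v(X)`, i.e. the linear entropy of `{t v | 0 ≤ t ≤ 1}`; it is also
the value `‖v‖_X` of the entropy seminorm of `X`. -/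
def directionalEntropy {A : Type*} [TopologicalSpace A] (X : Subshift A) (v : Plane) : ENNReal :=
  linearEntropy X ((fun t : ℝ => t • v) '' Set.Icc 0 1)

/-- The entropy seminorm of `X` is nontrivial: it does not vanish identically. -/
def HasNontrivialEntropyNorm {A : Type*} [TopologicalSpace A] (X : Subshift A) : Prop :=
  ∃ v : Plane, directionalEntropy X v ≠ 0

end PolygonalShift

end

/-! The strips around a segment code a triangle over it whose shape depends only on `P`. Fix a unit
direction `(a, b)`. The vertices where the normal form `(-b, a)` is maximal span at most one edge,
as do those where it is minimal; if both were edges, they would be antiparallel. So some vertex is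
the unique maximum or minimum, and by compactness of the circle its gap to the other vertices is
bounded below (`exists_uniform_gap`). Seen from that vertex, `P` lies in a cone of bounded aperture
around the normal (`exists_uniform_cone`).

Place translates of `P` with this vertex at the point to be determined. Their other points are lower
and stay in a triangle with sides of slope `±1 / κ`, so a neighbourhood of fixed width of the base
determines the whole triangle by induction on height (`codes_triangle`). A triangle over a base of
length `m` contains a disc of radius proportional to `m`, hence a translate of any strip of
comparable length in any other direction (`exists_complexity_le`). Counting patterns gives `h_v ≤ K
h_u` with `K` depending only on `P` and `‖v‖`; finiteness follows because a strip of fixed width has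
linearly many lattice points. -/

namespace PolygonalShift

open Filter
open scoped Pointwise

/-! ### Extremal vertices of linear forms and cones containing the polygon. -/

namespace ConvexIntegerPolygon

/-- The value at the `i`-th vertex of the linear form with coefficients `a`, `b`. -/
def form (P : ConvexIntegerPolygon) (a b : ℝ) (i : Fin P.n) : ℝ :=
  a * (P.vertex i).1 + b * (P.vertex i).2

theorem form_neg (P : ConvexIntegerPolygon) (a b : ℝ) (i : Fin P.n) :
    P.form (-a) (-b) i = -P.form a b i := by
  simp only [form]; ring

theorem left_of_edge_real (P : ConvexIntegerPolygon) {i j : Fin P.n} (h₁ : j ≠ i)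
    (h₂ : j ≠ finRotate P.n i) :
    (0 : ℝ) < (((P.vertex (finRotate P.n i)).1 : ℝ) - (P.vertex i).1) *
        ((P.vertex j).2 - (P.vertex i).2) -
      ((P.vertex (finRotate P.n i)).2 - (P.vertex i).2) * ((P.vertex j).1 - (P.vertex i).1) := by
  have h := P.left_of_edge i j h₁ h₂
  simp only [cross, Prod.fst_sub, Prod.snd_sub] at h
  exact_mod_cast h

theorem nonempty_vertices (P : ConvexIntegerPolygon) : Nonempty (Fin P.n) :=
  ⟨⟨0, by have := P.three_le; omega⟩⟩

theorem exists_ne_ne (P : ConvexIntegerPolygon) (i j : Fin P.n) : ∃ l, l ≠ i ∧ l ≠ j := by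
  by_contra! h
  have hsub : (Finset.univ : Finset (Fin P.n)) ⊆ {i, j} := fun l _ => by
    by_cases hl : l = i
    · simp [hl]
    · simp [h l hl]
  have := Finset.card_le_card hsub
  have h2 := Finset.card_le_two (a := i) (b := j)
  have := P.three_le
  simp only [Finset.card_univ, Fintype.card_fin] at *
  omega

/-- Two different vertices maximizing the same linear form span an edge. -/
theorem adjacent_of_form_max (P : ConvexIntegerPolygon) {a b : ℝ} (hab : a ^ 2 + b ^ 2 = 1)
    {i j : Fin P.n} (hij : j ≠ i) (hi : ∀ k, P.form a b k ≤ P.form a b i)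
    (hj : P.form a b j = P.form a b i) :
    finRotate P.n i = j ∨ finRotate P.n j = i := by
  by_contra! h
  obtain ⟨h₁, h₂⟩ := h
  set l := (finRotate P.n).symm i with hl
  have hli : finRotate P.n l = i := (finRotate P.n).apply_symm_apply i
  have hjl : j ≠ l := fun e => h₂ (by rw [e, hli])
  have hA := P.left_of_edge_real hij (Ne.symm h₁)
  have hB := P.left_of_edge_real (i := l) (j := j) hjl (by rwa [hli])
  rw [hli] at hB
  have hA' := hi (finRotate P.n i)
  have hB' := hi l
  simp only [form] at hA' hB' hj
  generalize ((P.vertex i).1 : ℝ) = i₁ at *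
  generalize ((P.vertex i).2 : ℝ) = i₂ at *
  generalize ((P.vertex j).1 : ℝ) = j₁ at *
  generalize ((P.vertex j).2 : ℝ) = j₂ at *
  generalize ((P.vertex l).1 : ℝ) = l₁ at *
  generalize ((P.vertex l).2 : ℝ) = l₂ at *
  generalize ((P.vertex (finRotate P.n i)).1 : ℝ) = k₁ at *
  generalize ((P.vertex (finRotate P.n i)).2 : ℝ) = k₂ at *
  -- Since the form agrees at `i` and `j`, `j - i = c (-b, a)`. The edge leaving `i` forces `c < 0`
  -- and the edge entering `i` forces `c > 0`.
  set c := a * (j₂ - i₂) - b * (j₁ - i₁) with hc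
  have e₁ : (k₁ - i₁) * (j₂ - i₂) - (k₂ - i₂) * (j₁ - i₁) =
      c * (a * (k₁ - i₁) + b * (k₂ - i₂)) := by
    rw [hc]
    linear_combination (-((k₁ - i₁) * (j₂ - i₂) - (k₂ - i₂) * (j₁ - i₁))) * hab +
      (b * (k₁ - i₁) - a * (k₂ - i₂)) * hj
  have e₂ : (i₁ - l₁) * (j₂ - l₂) - (i₂ - l₂) * (j₁ - l₁) =
      c * (a * (i₁ - l₁) + b * (i₂ - l₂)) := by
    rw [hc]
    linear_combination (-((i₁ - l₁) * (j₂ - i₂) - (i₂ - l₂) * (j₁ - i₁))) * hab +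
      (b * (i₁ - l₁) - a * (i₂ - l₂)) * hj
  rw [e₁] at hA
  rw [e₂] at hB
  have hc₁ : c < 0 := by
    by_contra! hc0
    nlinarith [mul_nonneg hc0 (show 0 ≤ -(a * (k₁ - i₁) + b * (k₂ - i₂)) by linarith)]
  nlinarith [mul_nonneg (neg_pos.2 hc₁).le (show 0 ≤ a * (i₁ - l₁) + b * (i₂ - l₂) by linarith)]

/-- If a linear form attains its maximum on an edge and its minimum on another one, then these
edges are antiparallel. -/
theorem antiparallel_of_form_max_min (P : ConvexIntegerPolygon) {a b : ℝ}
    (hab : a ^ 2 + b ^ 2 = 1) {i k : Fin P.n} (hi : ∀ l, P.form a b l ≤ P.form a b i)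
    (hi' : P.form a b (finRotate P.n i) = P.form a b i) (hk : ∀ l, P.form a b k ≤ P.form a b l)
    (hk' : P.form a b (finRotate P.n k) = P.form a b k) :
    Antiparallel (P.edge i) (P.edge k) := by
  -- An edge on which the form is constant equals `e (-b, a)`, and the cross product in
  -- `left_of_edge` becomes `e` times the drop of the form. Hence `e > 0` on the maximal edge and `f
  -- < 0` on the minimal one.
  have key : ∀ p l : Fin P.n, P.form a b (finRotate P.n p) = P.form a b p → l ≠ p →
      l ≠ finRotate P.n p →
      0 < (a * ((P.vertex (finRotate P.n p)).2 - (P.vertex p).2) -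
        b * ((P.vertex (finRotate P.n p)).1 - (P.vertex p).1)) *
          (P.form a b p - P.form a b l) := by
    intro p l hp h₁ h₂
    have h := P.left_of_edge_real h₁ h₂
    simp only [form] at hp ⊢
    convert h using 1
    generalize ((P.vertex p).1 : ℝ) = i₁ at *
    generalize ((P.vertex p).2 : ℝ) = i₂ at *
    generalize ((P.vertex l).1 : ℝ) = l₁ at *
    generalize ((P.vertex l).2 : ℝ) = l₂ at *
    generalize ((P.vertex (finRotate P.n p)).1 : ℝ) = k₁ at *
    generalize ((P.vertex (finRotate P.n p)).2 : ℝ) = k₂ at *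
    linear_combination ((k₁ - i₁) * (l₂ - i₂) - (k₂ - i₂) * (l₁ - i₁)) * hab -
      (a * (l₂ - i₂) - b * (l₁ - i₁)) * hp
  have hlt : P.form a b k < P.form a b i := by
    obtain ⟨l, hl₁, hl₂⟩ := P.exists_ne_ne i (finRotate P.n i)
    have h := key i l hi' hl₁ hl₂
    rcases (hi k).lt_or_eq with h' | h'
    · exact h'
    · have : P.form a b i - P.form a b l = 0 := by linarith [hi l, hk l]
      simp [this] at h
  have h₁ := key i k hi' (by rintro rfl; exact hlt.ne rfl) (by rintro rfl; exact hlt.ne hi')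
  have h₂ := key k i hk' (by rintro rfl; exact hlt.ne rfl) (by rintro rfl; exact hlt.ne hk'.symm)
  simp only [form] at hi' hk'
  set e := a * (((P.vertex (finRotate P.n i)).2 : ℝ) - (P.vertex i).2) -
        b * ((P.vertex (finRotate P.n i)).1 - (P.vertex i).1) with he
  set f := a * (((P.vertex (finRotate P.n k)).2 : ℝ) - (P.vertex k).2) -
        b * ((P.vertex (finRotate P.n k)).1 - (P.vertex k).1) with hf
  have he0 : 0 < e := pos_of_mul_pos_left h₁ (by linarith)
  have hf0 : f < 0 := by
    by_contra! h0
    nlinarith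
  have hE1 : ((P.vertex (finRotate P.n i)).1 : ℝ) - (P.vertex i).1 = -b * e := by
    rw [he]; linear_combination (-(((P.vertex (finRotate P.n i)).1 : ℝ) - (P.vertex i).1)) * hab +
      a * hi'
  have hE2 : ((P.vertex (finRotate P.n i)).2 : ℝ) - (P.vertex i).2 = a * e := by
    rw [he]; linear_combination (-(((P.vertex (finRotate P.n i)).2 : ℝ) - (P.vertex i).2)) * hab +
      b * hi'
  have hF1 : ((P.vertex (finRotate P.n k)).1 : ℝ) - (P.vertex k).1 = -b * f := by
    rw [hf]; linear_combination (-(((P.vertex (finRotate P.n k)).1 : ℝ) - (P.vertex k).1)) * hab +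
      a * hk'
  have hF2 : ((P.vertex (finRotate P.n k)).2 : ℝ) - (P.vertex k).2 = a * f := by
    rw [hf]; linear_combination (-(((P.vertex (finRotate P.n k)).2 : ℝ) - (P.vertex k).2)) * hab +
      b * hk'
  clear_value e f
  refine ⟨-f / e, div_pos (neg_pos.2 hf0) he0, ?_⟩
  ext m
  fin_cases m
  · simp [edge, toPlane] at *
    rw [hF1, ← neg_sub, hE1]
    field_simp
  · simp [edge, toPlane] at *
    rw [hF2, ← neg_sub, hE2]
    field_simp

/-- Every nonzero linear form is maximized or minimized at a single vertex. -/
theorem NoAntiparallelSides.exists_strict_extremum {P : ConvexIntegerPolygon}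
    (hP : P.NoAntiparallelSides) {a b : ℝ} (hab : a ^ 2 + b ^ 2 = 1) :
    ∃ i : Fin P.n, ∃ σ : ℝ, σ ^ 2 = 1 ∧ ∀ j ≠ i, 0 < σ * (P.form a b i - P.form a b j) := by
  have := P.nonempty_vertices
  have side : ∀ a b : ℝ, a ^ 2 + b ^ 2 = 1 → (∃ i, ∀ j ≠ i, P.form a b j < P.form a b i) ∨
      ∃ i, (∀ k, P.form a b k ≤ P.form a b i) ∧
        P.form a b (finRotate P.n i) = P.form a b i := by
    intro a b hab
    obtain ⟨i, hi⟩ := Finite.exists_max (P.form a b)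
    by_cases h : ∀ j ≠ i, P.form a b j < P.form a b i
    · exact Or.inl ⟨i, h⟩
    · push Not at h
      obtain ⟨j, hji, hj⟩ := h
      have hj' := le_antisymm (hi j) hj
      rcases P.adjacent_of_form_max hab hji hi hj' with h | h
      · exact Or.inr ⟨i, hi, by rw [h, hj']⟩
      · exact Or.inr ⟨j, fun k => (hi k).trans hj, by rw [h, hj']⟩
  rcases side a b hab with ⟨i, hi⟩ | ⟨i, hi, hi'⟩
  · exact ⟨i, 1, by norm_num, fun j hj => by linarith [hi j hj]⟩
  rcases side (-a) (-b) (by linarith) with ⟨k, hk⟩ | ⟨k, hk, hk'⟩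
  · refine ⟨k, -1, by norm_num, fun j hj => ?_⟩
    have := hk j hj
    rw [form_neg, form_neg] at this
    linarith
  · simp only [form_neg, neg_le_neg_iff, neg_inj] at hk hk'
    exact absurd (P.antiparallel_of_form_max_min hab hi hi' hk hk') (hP i k)

/-- Compactness of the unit circle: the directions with gap greater than `1 / (m + 1)` form an
increasing open cover. This makes the final constant independent of the direction and of the
subshift. -/
theorem NoAntiparallelSides.exists_uniform_gap {P : ConvexIntegerPolygon}
    (hP : P.NoAntiparallelSides) :
    ∃ γ : ℝ, 0 < γ ∧ ∀ a b : ℝ, a ^ 2 + b ^ 2 = 1 →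
      ∃ i : Fin P.n, ∃ σ : ℝ, σ ^ 2 = 1 ∧ ∀ j ≠ i, γ ≤ σ * (P.form a b i - P.form a b j) := by
  let S : Set (ℝ × ℝ) := {p | p.1 ^ 2 + p.2 ^ 2 = 1}
  have hS : IsCompact S := by
    refine Metric.isCompact_of_isClosed_isBounded
      (isClosed_eq (by fun_prop) continuous_const) ?_
    refine (Metric.isBounded_Icc (-1 : ℝ × ℝ) 1).subset fun p hp => ?_
    have hp' : p.1 ^ 2 + p.2 ^ 2 = 1 := hp
    refine ⟨⟨?_, ?_⟩, ⟨?_, ?_⟩⟩ <;> simp <;> nlinarith [sq_nonneg p.1, sq_nonneg p.2]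
  let U : ℕ → Set (ℝ × ℝ) := fun m => {p | ∃ i : Fin P.n, ∃ σ : ℝ, σ ^ 2 = 1 ∧
    ∀ j ≠ i, 1 / ((m : ℝ) + 1) < σ * (P.form p.1 p.2 i - P.form p.1 p.2 j)}
  have hU : ∀ m, IsOpen (U m) := by
    intro m
    have : U m = ⋃ i : Fin P.n, ⋃ σ : ℝ, ⋃ _ : σ ^ 2 = 1, ⋂ j : Fin P.n, ⋂ _ : j ≠ i,
        {p | 1 / ((m : ℝ) + 1) < σ * (P.form p.1 p.2 i - P.form p.1 p.2 j)} := by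
      ext p; simp [U]
    rw [this]
    refine isOpen_iUnion fun i => isOpen_iUnion fun σ => isOpen_iUnion fun _ =>
      isOpen_iInter_of_finite fun j => isOpen_iInter_of_finite fun _ =>
        isOpen_lt continuous_const ?_
    simp only [form]
    fun_prop
  have hmono : Monotone U := by
    rintro m n hmn p ⟨i, σ, hσ, h⟩
    exact ⟨i, σ, hσ, fun j hj => (Nat.one_div_le_one_div hmn).trans_lt (h j hj)⟩
  have hcover : S ⊆ ⋃ m, U m := by
    intro p hp
    obtain ⟨i, σ, hσ, h⟩ := hP.exists_strict_extremum (show p.1 ^ 2 + p.2 ^ 2 = 1 from hp)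
    have : ∃ m : ℕ, ∀ j ∈ Finset.univ.filter (· ≠ i),
        1 / ((m : ℝ) + 1) < σ * (P.form p.1 p.2 i - P.form p.1 p.2 j) := by
      have hev : ∀ᶠ m : ℕ in atTop, ∀ j ∈ Finset.univ.filter (· ≠ i),
          1 / ((m : ℝ) + 1) < σ * (P.form p.1 p.2 i - P.form p.1 p.2 j) := by
        rw [Filter.eventually_all_finset]
        intro j hj
        exact tendsto_one_div_add_atTop_nhds_zero_nat.eventually_lt_const
          (h j (Finset.mem_filter.1 hj).2)
      exact hev.exists
    obtain ⟨m, hm⟩ := this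
    exact Set.mem_iUnion.2 ⟨m, i, σ, hσ, fun j hj => hm j (by simpa using hj)⟩
  obtain ⟨m, hm⟩ := hS.elim_directed_cover U hU hcover hmono.directed_le
  refine ⟨1 / ((m : ℝ) + 1), by positivity, fun a b hab => ?_⟩
  obtain ⟨i, σ, hσ, h⟩ := hm (show (a, b) ∈ S from hab)
  exact ⟨i, σ, hσ, fun j hj => (h j hj).le⟩

/-- A closed half-plane that contains the vertices contains the polygon. -/
theorem region_le (P : ConvexIntegerPolygon) {a b c : ℝ} (h : ∀ i, P.form a b i ≤ c)
    {q : ℤ × ℤ} (hq : q ∈ latticePoints P.region) : a * q.1 + b * q.2 ≤ c := by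
  have hconv : Convex ℝ {x : Plane | a * x 0 + b * x 1 ≤ c} := by
    intro x hx y hy s t hs ht hst
    simp only [Set.mem_ofPred_eq, PiLp.add_apply, PiLp.smul_apply, smul_eq_mul] at *
    have : c = s * c + t * c := by rw [← add_mul, hst, one_mul]
    nlinarith [mul_le_mul_of_nonneg_left hx hs, mul_le_mul_of_nonneg_left hy ht]
  have hsub : P.region ⊆ {x : Plane | a * x 0 + b * x 1 ≤ c} := by
    refine convexHull_min ?_ hconv
    rintro _ ⟨i, rfl⟩
    simpa [toPlane, form] using h i
  simpa [toPlane] using hsub hq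

/-- Seen from a suitable vertex, the polygon lies in a cone of bounded aperture around one of the
two normals of a given direction. -/
theorem NoAntiparallelSides.exists_uniform_cone {P : ConvexIntegerPolygon}
    (hP : P.NoAntiparallelSides) :
    ∃ κ d : ℝ, 0 < κ ∧ 0 < d ∧ ∀ a b : ℝ, a ^ 2 + b ^ 2 = 1 →
      ∃ i : Fin P.n, ∃ σ : ℝ, σ ^ 2 = 1 ∧ ∀ q ∈ latticePoints P.region,
        |a * ((P.vertex i).1 - q.1) + b * ((P.vertex i).2 - q.2)| ≤
          κ * (σ * (a * ((P.vertex i).2 - q.2) - b * ((P.vertex i).1 - q.1))) ∧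
        σ * (a * ((P.vertex i).2 - q.2) - b * ((P.vertex i).1 - q.1)) ≤ d := by
  obtain ⟨γ, hγ, hgap⟩ := hP.exists_uniform_gap
  let m : Fin P.n × Fin P.n → ℝ := fun p =>
    |((P.vertex p.1).1 : ℝ) - (P.vertex p.2).1| + |((P.vertex p.1).2 : ℝ) - (P.vertex p.2).2|
  obtain ⟨M, hM⟩ := (Set.finite_range m).bddAbove
  set d := max M 1 with hd
  have hd0 : 0 < d := by positivity
  have hbound : ∀ i j, ∀ a b : ℝ, a ^ 2 + b ^ 2 = 1 → P.form a b i - P.form a b j ≤ d := by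
    intro i j a b hab
    have h1 : m (i, j) ≤ d := (hM ⟨(i, j), rfl⟩).trans (le_max_left _ _)
    have ha : |a| ≤ 1 := abs_le_one_iff_mul_self_le_one.2 (by nlinarith [sq_nonneg b])
    have hb : |b| ≤ 1 := abs_le_one_iff_mul_self_le_one.2 (by nlinarith [sq_nonneg a])
    have hx := le_abs_self (a * (((P.vertex i).1 : ℝ) - (P.vertex j).1))
    have hy := le_abs_self (b * (((P.vertex i).2 : ℝ) - (P.vertex j).2))
    rw [abs_mul] at hx hy
    have hx' := mul_le_mul_of_nonneg_right ha (abs_nonneg (((P.vertex i).1 : ℝ) - (P.vertex j).1))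
    have hy' := mul_le_mul_of_nonneg_right hb (abs_nonneg (((P.vertex i).2 : ℝ) - (P.vertex j).2))
    simp only [form, m] at *
    linarith
  -- Differences of unit forms between vertices are at most `d`, while the normal drop is at least
  -- `γ`; the ratio bounds the slope of the cone.
  refine ⟨d / γ, d, div_pos hd0 hγ, hd0, fun a b hab => ?_⟩
  obtain ⟨i, σ, hσ, h⟩ := hgap (-b) a (by linarith)
  have hvert : ∀ j, P.form a b i - P.form a b j ≤
        d / γ * (σ * (P.form (-b) a i - P.form (-b) a j)) ∧
      P.form a b j - P.form a b i ≤ d / γ * (σ * (P.form (-b) a i - P.form (-b) a j)) ∧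
      σ * (P.form (-b) a i - P.form (-b) a j) ≤ d := by
    intro j
    by_cases hj : j = i
    · subst hj; simp [hd0.le]
    · have h1 : d ≤ d / γ * (σ * (P.form (-b) a i - P.form (-b) a j)) := by
        calc d = d / γ * γ := by field_simp
          _ ≤ _ := mul_le_mul_of_nonneg_left (h j hj) (by positivity)
      refine ⟨(hbound i j a b hab).trans h1, (hbound j i a b hab).trans h1, ?_⟩
      rcases mul_self_eq_one_iff.1 ((sq σ).symm.trans hσ) with rfl | rfl
      · simpa using hbound i j (-b) a (by linarith)
      · linarith [hbound j i (-b) a (by linarith)]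
  refine ⟨i, σ, hσ, fun q hq => ⟨abs_le'.2 ⟨?_, ?_⟩, ?_⟩⟩
  -- Each side of the cone, and the height bound, is a half-plane, so checking the vertices
  -- suffices.
  · have := P.region_le (a := -a - d / γ * σ * b) (b := -b + d / γ * σ * a)
      (c := P.form (-a - d / γ * σ * b) (-b + d / γ * σ * a) i)
      (fun j => by have := (hvert j).1; simp only [form] at *; linarith) hq
    simp only [form] at *
    linarith
  · have := P.region_le (a := a - d / γ * σ * b) (b := b + d / γ * σ * a)
      (c := P.form (a - d / γ * σ * b) (b + d / γ * σ * a) i)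
      (fun j => by have := (hvert j).2.1; simp only [form] at *; linarith) hq
    simp only [form] at *
    linarith
  · have := P.region_le (a := σ * b) (b := -σ * a) (c := d + P.form (σ * b) (-σ * a) i)
      (fun j => by have := (hvert j).2.2; simp only [form] at *; linarith) hq
    simp only [form] at *
    linarith

end ConvexIntegerPolygon

theorem toPlane_injective : Function.Injective toPlane := by
  intro x y h
  have h0 := congrArg (fun v : Plane => v 0) h
  have h1 := congrArg (fun v : Plane => v 1) h
  simp [toPlane] at h0 h1
  exact Prod.ext h0 h1

/-- The segment from the origin to `v`. -/
def segmentTo (v : Plane) : Set Plane := (fun t : ℝ => t • v) '' Set.Icc 0 1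

/-! ### Coding by height and comparison of pattern counts. -/

section Coding

variable {A : Type*} [TopologicalSpace A] {X : Subshift A}

theorem codes_of_subset {R S : Set Plane} (h : S ⊆ R) : Codes X R S :=
  fun _ _ _ _ hxy _ hz => hxy (h hz)

/-- A set is coded by a subset from which it can be filled up by placing translates of the polygon
in the order given by a height function. -/
theorem IsPolygonal.codes_of_height {P : ConvexIntegerPolygon} (hX : IsPolygonal X P)
    (i : Fin P.n) {B T : Set Plane} {ε : ℝ} (hε : 0 < ε) (ℓ : ℤ × ℤ → ℝ)
    (hT : ∀ z ∈ latticePoints T, z ∉ latticePoints B → ∀ q ∈ latticePoints P.region,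
      q ≠ P.vertex i → z - P.vertex i + q ∈ latticePoints T ∧
        ℓ (z - P.vertex i + q) + ε ≤ ℓ z)
    (h0 : ∀ z ∈ latticePoints T, 0 ≤ ℓ z) : Codes X B T := by
  intro x hx y hy hB
  -- Heights are nonnegative and drop by at least `ε` at each use of the polygon, so induction on
  -- height levels terminates.
  have main : ∀ n : ℕ, ∀ z ∈ latticePoints T, ℓ z < n * ε → x z = y z := by
    intro n
    induction n with
    | zero =>
      intro z hz h
      have := h0 z hz
      simp at h
      linarith
    | succ n ih =>
      intro z hz hn
      by_cases hzB : z ∈ latticePoints B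
      · exact hB hzB
      have := hX.2 i _ (X.shift_mem (z - P.vertex i) x hx) _ (X.shift_mem (z - P.vertex i) y hy)
        (fun q hq => ?_) (show P.vertex i ∈ latticePoints {toPlane (P.vertex i)} from rfl)
      · simpa using this
      · have hq' : q ≠ P.vertex i := fun h => hq.2 (by rw [h]; rfl)
        obtain ⟨h1, h2⟩ := hT z hz hzB q hq.1 hq'
        refine ih _ h1 ?_
        push_cast at hn
        linarith
  intro z hz
  obtain ⟨n, hn⟩ := exists_nat_gt (ℓ z / ε)
  exact main n z hz ((div_lt_iff₀ hε).1 hn)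

theorem complexity_le_of_codes [Finite A] {R S S' : Set Plane} (w : ℤ × ℤ) (h : Codes X R S)
    (hR : (latticePoints R).Finite)
    (hS : ∀ z ∈ latticePoints S', z + w ∈ latticePoints S) :
    complexity X S' ≤ complexity X R := by
  have := hR.to_subtype
  -- `U` contains one element of `X` for each pattern on `S'`; shifting by `-w` and restricting to
  -- `R` is injective on it.
  obtain ⟨U, hU, hinj, himg⟩ :=
    (Set.surjOn_image (latticePoints S').domRestrict X.carrier).exists_subset_injOn_image_eq
  unfold complexity
  rw [← himg, hinj.ncard_image]
  refine Set.ncard_le_ncard_of_injOn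
    (fun x => (latticePoints R).domRestrict (fun v => x (-w + v))) ?_ ?_ (Set.toFinite _)
  · intro x hx
    exact ⟨_, X.shift_mem (-w) x (hU hx), rfl⟩
  · intro x hx y hy hxy
    refine hinj hx hy (funext fun z => ?_)
    have := h _ (X.shift_mem (-w) x (hU hx)) _ (X.shift_mem (-w) y (hU hy))
      (fun v hv => congrFun hxy ⟨v, hv⟩) (hS z z.2)
    simpa using this

end Coding

/-- The neighbourhoods of a dilated unit segment contain linearly many lattice points. -/
theorem exists_card_latticePoints_le (r : ℝ) : ∃ c : ℕ, ∀ u : Plane, ‖u‖ = 1 → ∀ m : ℕ,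
    (latticePoints (Metric.thickening r ((m : ℝ) • segmentTo u))).Finite ∧
    (latticePoints (Metric.thickening r ((m : ℝ) • segmentTo u))).ncard ≤ c * (m + 1) := by
  obtain ⟨R, hR⟩ := exists_nat_gt (r + 2)
  -- One box per integer `k ≤ m`, around the rounded point `k u`. Rounding the parameter and then
  -- the coordinate costs at most 1 each, hence `R > r + 2`.
  refine ⟨(2 * R + 1) * (2 * R + 1), fun u hu m => ?_⟩
  let F : Finset (ℤ × ℤ) := (Finset.range (m + 1)).biUnion fun k : ℕ =>
    Finset.Icc (⌊(k : ℝ) * u 0⌋ - R) (⌊(k : ℝ) * u 0⌋ + R) ×ˢ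
      Finset.Icc (⌊(k : ℝ) * u 1⌋ - R) (⌊(k : ℝ) * u 1⌋ + R)
  have hsub : latticePoints (Metric.thickening r ((m : ℝ) • segmentTo u)) ⊆ F := by
    intro z hz
    obtain ⟨_, ⟨_, ⟨t, ⟨ht0, ht1⟩, rfl⟩, rfl⟩, hd⟩ := Metric.mem_thickening_iff.1 hz
    have hmt : 0 ≤ (m : ℝ) * t := by positivity
    set k := ⌊(m : ℝ) * t⌋₊ with hk
    have hk1 : (k : ℝ) ≤ m * t := Nat.floor_le hmt
    have hk2 : (m : ℝ) * t < k + 1 := Nat.lt_floor_add_one _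
    have hkm : k < m + 1 := by
      have : (k : ℝ) ≤ m := hk1.trans (mul_le_of_le_one_right (by positivity) ht1)
      exact Nat.lt_succ_of_le (by exact_mod_cast this)
    have hcoord : ∀ j : Fin 2, |toPlane z j - ⌊(k : ℝ) * u j⌋| < R := by
      intro j
      have h1 : |toPlane z j - m * t * u j| < r := by
        refine lt_of_le_of_lt ?_ hd
        rw [dist_eq_norm]
        refine le_trans (le_of_eq ?_) (PiLp.norm_apply_le _ j)
        simp [mul_assoc]
      have hu1 : |u j| ≤ 1 := by
        rw [← hu]; exact PiLp.norm_apply_le u j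
      have h2 : |m * t * u j - k * u j| ≤ 1 := by
        rw [← sub_mul, abs_mul]
        exact mul_le_one₀ (abs_le.2 ⟨by linarith, by linarith⟩) (abs_nonneg _) hu1
      have h3 := Int.floor_le ((k : ℝ) * u j)
      have h4 := Int.lt_floor_add_one ((k : ℝ) * u j)
      rw [abs_lt] at h1 ⊢
      rw [abs_le] at h2
      constructor <;> linarith
    have h0 := abs_lt.1 (hcoord 0)
    have h1 := abs_lt.1 (hcoord 1)
    simp only [toPlane, PiLp.toLp_apply, Matrix.cons_val_zero, Matrix.cons_val_one] at h0 h1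
    simp only [F, Finset.coe_biUnion, Set.mem_iUnion, Finset.coe_product, Set.mem_prod,
      Finset.coe_Icc, Set.mem_Icc, Finset.coe_range, Set.mem_Iio]
    refine ⟨k, hkm, ⟨?_, ?_⟩, ?_, ?_⟩
    · have : ((⌊(k : ℝ) * u 0⌋ - R : ℤ) : ℝ) ≤ z.1 := by push_cast; linarith
      exact_mod_cast this
    · have : (z.1 : ℝ) ≤ (⌊(k : ℝ) * u 0⌋ + R : ℤ) := by push_cast; linarith
      exact_mod_cast this
    · have : ((⌊(k : ℝ) * u 1⌋ - R : ℤ) : ℝ) ≤ z.2 := by push_cast; linarith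
      exact_mod_cast this
    · have : (z.2 : ℝ) ≤ (⌊(k : ℝ) * u 1⌋ + R : ℤ) := by push_cast; linarith
      exact_mod_cast this
  refine ⟨F.finite_toSet.subset hsub, ?_⟩
  calc _ ≤ (F : Set (ℤ × ℤ)).ncard := Set.ncard_le_ncard hsub F.finite_toSet
    _ = F.card := Set.ncard_coe_finset F
    _ ≤ (Finset.range (m + 1)).card * ((2 * R + 1) * (2 * R + 1)) := by
        refine Finset.card_biUnion_le_card_mul _ _ _ fun k _ => ?_
        rw [Finset.card_product, Int.card_Icc, Int.card_Icc]
        refine Nat.mul_le_mul ?_ ?_ <;> omega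
    _ = _ := by rw [Finset.card_range, mul_comm]

/-- Nonzero lattice vectors have length at least 1, so those in the cone have height bounded below.
This is the `ε` of the height induction. -/
theorem one_div_le_of_mem_cone {κ s t : ℝ} (hκ : 0 < κ) (ht : |t| ≤ κ * s)
    (h : 1 ≤ t ^ 2 + s ^ 2) : 1 / (1 + κ) ≤ s := by
  have hs : 0 ≤ s := nonneg_of_mul_nonneg_right ((abs_nonneg _).trans ht) hκ
  have ht2 : t ^ 2 ≤ (κ * s) ^ 2 := by
    rw [← sq_abs t]; gcongr
  rw [div_le_iff₀ (by positivity), ← one_le_sq_iff₀ (by positivity)]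
  nlinarith [mul_nonneg (sq_nonneg s) hκ.le]

/-! ### Triangles and discs coded by strips. -/

/-- The component of `x` along the direction `(a, b)`. -/
def tangentForm (a b : ℝ) (x : Plane) : ℝ := a * x 0 + b * x 1

/-- The component of `x` along the normal `σ • (-b, a)`. -/
def normalForm (a b σ : ℝ) (x : Plane) : ℝ := σ * (a * x 1 - b * x 0)

/-- The triangle over the base `[0, m] • (a, b)`, on the side given by the sign `σ`, whose two other
sides have slope `±1 / κ` relative to the base. -/
def triangle (a b σ κ m : ℝ) : Set Plane :=
  {x | 0 ≤ normalForm a b σ x ∧ κ * normalForm a b σ x ≤ tangentForm a b x ∧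
    tangentForm a b x ≤ m - κ * normalForm a b σ x}

/-- A neighbourhood of its base codes a triangle into which the polygon fits at the apex. -/
theorem IsPolygonal.codes_triangle {A : Type*} [TopologicalSpace A] {X : Subshift A}
    {P : ConvexIntegerPolygon} (hX : IsPolygonal X P) {κ d a b σ : ℝ} (hκ : 0 < κ)
    (hab : a ^ 2 + b ^ 2 = 1) (hσ : σ ^ 2 = 1) {u : Plane} (hua : u 0 = a) (hub : u 1 = b)
    {i : Fin P.n} (hw : ∀ q ∈ latticePoints P.region,
        |a * ((P.vertex i).1 - q.1) + b * ((P.vertex i).2 - q.2)| ≤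
          κ * (σ * (a * ((P.vertex i).2 - q.2) - b * ((P.vertex i).1 - q.1))) ∧
        σ * (a * ((P.vertex i).2 - q.2) - b * ((P.vertex i).1 - q.1)) ≤ d) (m : ℕ) :
    Codes X (Metric.thickening d ((m : ℝ) • segmentTo u)) (triangle a b σ κ m) := by
  refine hX.codes_of_height i (ε := 1 / (1 + κ)) (by positivity)
    (fun z => normalForm a b σ (toPlane z)) ?_ (fun z hz => hz.1)
  intro z hz hzB q hq hqw
  have ⟨hz0, hz1, hz2⟩ := hz
  -- A point of the triangle projects orthogonally into the base, so outside the strip its height is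
  -- at least `d`, and the polygon hung from it does not cross the base.
  have hzd : d ≤ normalForm a b σ (toPlane z) := by
    by_contra! hlt
    refine hzB (Metric.mem_thickening_iff.2 ⟨tangentForm a b (toPlane z) • u, ?_, ?_⟩)
    · have hτ0 : 0 ≤ tangentForm a b (toPlane z) := le_trans (by positivity) hz1
      have hτm : tangentForm a b (toPlane z) ≤ m := hz2.trans (by
        have : 0 ≤ κ * normalForm a b σ (toPlane z) := by positivity
        linarith)
      refine ⟨(tangentForm a b (toPlane z) / m) • u, ⟨tangentForm a b (toPlane z) / m, ⟨by positivity, ?_⟩, rfl⟩, ?_⟩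
      · exact div_le_one_of_le₀ hτm (by positivity)
      · rcases eq_or_ne (m : ℝ) 0 with h | h
        · have : tangentForm a b (toPlane z) = 0 := le_antisymm (h ▸ hτm) hτ0
          simp [this]
        · simp only [smul_smul]
          rw [mul_div_cancel₀ _ h]
    · refine lt_of_le_of_lt (le_of_eq ?_) hlt
      rw [EuclideanSpace.dist_eq, Real.sqrt_eq_iff_mul_self_eq (by positivity) hz0,
        Fin.sum_univ_two, Real.dist_eq, Real.dist_eq, sq_abs, sq_abs]
      simp only [normalForm, tangentForm, PiLp.smul_apply, smul_eq_mul, hua, hub]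
      generalize toPlane z 0 = x
      generalize toPlane z 1 = y
      linear_combination (-(a * y - b * x) ^ 2) * hσ -
          (x ^ 2 + y ^ 2 - (a * x + b * y) ^ 2) * hab
  obtain ⟨h1, h2⟩ := hw q hq
  set t' := a * (((P.vertex i).1 : ℝ) - q.1) + b * ((P.vertex i).2 - q.2) with ht'
  set s' := σ * (a * (((P.vertex i).2 : ℝ) - q.2) - b * ((P.vertex i).1 - q.1)) with hs'
  have hℓ : normalForm a b σ (toPlane (z - P.vertex i + q)) = normalForm a b σ (toPlane z) - s' := by
    simp [normalForm, toPlane, hs']; ring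
  have hτ : tangentForm a b (toPlane (z - P.vertex i + q)) = tangentForm a b (toPlane z) - t' := by
    simp [tangentForm, toPlane, ht']; ring
  have hs0 : 0 ≤ s' := by
    have := (abs_nonneg _).trans h1
    exact nonneg_of_mul_nonneg_right this hκ
  have hs1 : 1 / (1 + κ) ≤ s' := by
    have hint : (1 : ℝ) ≤ (((P.vertex i).1 : ℝ) - q.1) ^ 2 + (((P.vertex i).2 : ℝ) - q.2) ^ 2 := by
      have : 0 < ((P.vertex i).1 - q.1) ^ 2 + ((P.vertex i).2 - q.2) ^ 2 := by
        by_contra! h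
        have e1 : (P.vertex i).1 - q.1 = 0 := by nlinarith [sq_nonneg ((P.vertex i).2 - q.2)]
        have e2 : (P.vertex i).2 - q.2 = 0 := by nlinarith [sq_nonneg ((P.vertex i).1 - q.1)]
        exact hqw (Prod.ext (by linarith) (by linarith))
      have h' : (1 : ℤ) ≤ ((P.vertex i).1 - q.1) ^ 2 + ((P.vertex i).2 - q.2) ^ 2 := this
      exact_mod_cast h'
    have hsum : t' ^ 2 + s' ^ 2 =
        (((P.vertex i).1 : ℝ) - q.1) ^ 2 + (((P.vertex i).2 : ℝ) - q.2) ^ 2 := by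
      rw [ht', hs']
      generalize ((P.vertex i).1 : ℝ) - q.1 = x
      generalize ((P.vertex i).2 : ℝ) - q.2 = y
      linear_combination (a * y - b * x) ^ 2 * hσ + (x ^ 2 + y ^ 2) * hab
    exact one_div_le_of_mem_cone hκ h1 (hsum ▸ hint)
  obtain ⟨h3, h4⟩ := abs_le.1 h1
  -- The tangential shift is at most `κ s'`, exactly the amount by which `κ` times the height
  -- decreases, so both slanted sides are respected.
  refine ⟨⟨?_, ?_, ?_⟩, ?_⟩
  · rw [hℓ]; linarith
  · rw [hℓ, hτ]; linarith
  · rw [hℓ, hτ]; linarith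
  · simp only [hℓ]; linarith

/-- A neighbourhood of a dilated unit segment codes a disc of proportional size. -/
theorem exists_complexity_le {P : ConvexIntegerPolygon} (hP : P.NoAntiparallelSides) :
    ∃ ρ r₀ : ℝ, 0 < ρ ∧ ∀ (A : Type*) [Finite A] [TopologicalSpace A] (X : Subshift A),
      IsPolygonal X P → ∀ u v : Plane, ‖u‖ = 1 → ∀ (r : ℝ) (n m : ℕ),
        n * ‖v‖ + r + 1 ≤ ρ * m →
        complexity X (Metric.thickening r ((n : ℝ) • segmentTo v)) ≤
          complexity X (Metric.thickening r₀ ((m : ℝ) • segmentTo u)) := by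
  obtain ⟨κ, d, hκ, hd, hcone⟩ := hP.exists_uniform_cone
  refine ⟨1 / (4 * (2 * κ + 1)), d, by positivity, ?_⟩
  intro A _ _ X hX u v hu r n m hm
  -- The centre `(c₀, c₁)` lies at height `2 ρ m` over the midpoint of the base. Coordinates off by
  -- `ρ m` change either form by at most `2 ρ m`, so what is needed is `4 κ ρ m + 2 ρ m ≤ m / 2`.
  -- The `+ 1` in the hypothesis pays for rounding the centre to the lattice.
  set ρ := 1 / (4 * (2 * κ + 1)) with hρ
  have hρκ : ρ * (4 * κ + 2) = 1 / 2 := by rw [hρ]; field_simp; ring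
  obtain ⟨a, b, hab, hua, hub⟩ : ∃ a b : ℝ, a ^ 2 + b ^ 2 = 1 ∧ u 0 = a ∧ u 1 = b := by
    refine ⟨u 0, u 1, ?_, rfl, rfl⟩
    have := EuclideanSpace.real_norm_sq_eq u
    rw [hu, Fin.sum_univ_two] at this
    linarith
  obtain ⟨i, σ, hσ, hw⟩ := hcone a b hab
  have hcodes := hX.codes_triangle hκ hab hσ hua hub hw m
  obtain ⟨c, hc⟩ := exists_card_latticePoints_le d
  set s₀ := 2 * ρ * m with hs₀
  set c₀ := m / 2 * a - s₀ * σ * b with hc₀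
  set c₁ := m / 2 * b + s₀ * σ * a with hc₁
  refine complexity_le_of_codes (⌊c₀⌋, ⌊c₁⌋) hcodes (hc u hu m).1 ?_
  intro z hz
  obtain ⟨_, ⟨_, ⟨t, ⟨ht0, ht1⟩, rfl⟩, rfl⟩, hdist⟩ := Metric.mem_thickening_iff.1 hz
  have hcoord : ∀ j : Fin 2, |toPlane z j| ≤ ρ * m - 1 := by
    intro j
    calc |toPlane z j| ≤ ‖toPlane z‖ := PiLp.norm_apply_le (toPlane z) j
      _ ≤ dist (toPlane z) ((n : ℝ) • t • v) + ‖(n : ℝ) • t • v‖ := by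
          rw [dist_eq_norm]
          simpa using norm_add_le (toPlane z - (n : ℝ) • t • v) ((n : ℝ) • t • v)
      _ ≤ r + n * ‖v‖ := by
          refine add_le_add hdist.le ?_
          rw [norm_smul, norm_smul, Real.norm_natCast, Real.norm_of_nonneg ht0]
          exact mul_le_mul_of_nonneg_left (mul_le_of_le_one_left (norm_nonneg _) ht1)
            (by positivity)
      _ ≤ _ := by linarith
  have ha : |a| ≤ 1 := abs_le_one_iff_mul_self_le_one.2 (by nlinarith [sq_nonneg b])
  have hb : |b| ≤ 1 := abs_le_one_iff_mul_self_le_one.2 (by nlinarith [sq_nonneg a])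
  have hσ1 : |σ| = 1 := by rw [← sq_eq_sq₀ (abs_nonneg _) zero_le_one, sq_abs, hσ, one_pow]
  have h0 := hcoord 0
  have h1 := hcoord 1
  have f0 : |(⌊c₀⌋ : ℝ) - c₀| ≤ 1 :=
    abs_le.2 ⟨by linarith [Int.lt_floor_add_one c₀], by linarith [Int.floor_le c₀]⟩
  have f1 : |(⌊c₁⌋ : ℝ) - c₁| ≤ 1 :=
    abs_le.2 ⟨by linarith [Int.lt_floor_add_one c₁], by linarith [Int.floor_le c₁]⟩
  set x := toPlane z 0 + (⌊c₀⌋ - c₀) with hx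
  set y := toPlane z 1 + (⌊c₁⌋ - c₁) with hy
  have hx' : |x| ≤ ρ * m := (abs_add_le _ _).trans (by linarith)
  have hy' : |y| ≤ ρ * m := (abs_add_le _ _).trans (by linarith)
  have hform : ∀ p q : ℝ, |p| ≤ 1 → |q| ≤ 1 → |p * x + q * y| ≤ 2 * ρ * m := by
    intro p q hp hq
    calc |p * x + q * y| ≤ |p| * |x| + |q| * |y| := by
          rw [← abs_mul, ← abs_mul]; exact abs_add_le _ _
      _ ≤ 1 * (ρ * m) + 1 * (ρ * m) := by gcongr
      _ = _ := by ring
  have hℓ : normalForm a b σ (toPlane (z + (⌊c₀⌋, ⌊c₁⌋))) = s₀ + (-(σ * b) * x + σ * a * y) := by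
    simp only [normalForm, hx, hy, toPlane, PiLp.toLp_apply, Matrix.cons_val_zero, Matrix.cons_val_one,
      Prod.fst_add, Prod.snd_add, Int.cast_add]
    linear_combination (σ * a) * hc₁ - (σ * b) * hc₀ + s₀ * hσ + s₀ * σ ^ 2 * hab
  have hτ : tangentForm a b (toPlane (z + (⌊c₀⌋, ⌊c₁⌋))) = m / 2 + (a * x + b * y) := by
    simp only [tangentForm, hx, hy, toPlane, PiLp.toLp_apply, Matrix.cons_val_zero, Matrix.cons_val_one,
      Prod.fst_add, Prod.snd_add, Int.cast_add]
    linear_combination a * hc₀ + b * hc₁ + (m / 2) * hab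
  have g1 := abs_le.1 (hform (-(σ * b)) (σ * a) (by rw [abs_neg, abs_mul, hσ1, one_mul]; exact hb)
    (by rw [abs_mul, hσ1, one_mul]; exact ha))
  have g2 := abs_le.1 (hform a b ha hb)
  have hκℓ : κ * normalForm a b σ (toPlane (z + (⌊c₀⌋, ⌊c₁⌋))) ≤ m / 2 - 2 * ρ * m := by
    rw [hℓ]
    calc _ ≤ κ * (4 * ρ * m) := mul_le_mul_of_nonneg_left (by linarith) hκ.le
      _ = m / 2 - 2 * ρ * m := by linear_combination (m : ℝ) * hρκ
  refine ⟨?_, ?_, ?_⟩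
  · rw [hℓ]; linarith
  · rw [hτ]; linarith
  · rw [hτ]; linarith

/-! ### Growth rates and comparison of directional entropies. -/

variable {A : Type*} [TopologicalSpace A]

/-- The normalized logarithm of the complexity of the `r`-neighbourhood of the `n`-fold dilate of the
segment from the origin to `v`. -/
noncomputable def stripRate (X : Subshift A) (v : Plane) (r : ℝ) (n : ℕ) : ENNReal :=
  ENNReal.ofReal (Real.log (complexity X (Metric.thickening r ((n : ℝ) • segmentTo v))) / n)

/-- The growth rate of the logarithm of the complexity of the `r`-neighbourhoods of the dilates of
the segment from the origin to `v`. -/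
noncomputable def stripEntropy (X : Subshift A) (v : Plane) (r : ℝ) : ENNReal :=
  limsup (stripRate X v r) atTop

theorem directionalEntropy_eq (X : Subshift A) (v : Plane) :
    directionalEntropy X v = limsup (stripEntropy X v) atTop := rfl

theorem log_natCast_mono {m n : ℕ} (h : m ≤ n) : Real.log m ≤ Real.log n := by
  rcases Nat.eq_zero_or_pos m with rfl | hm
  · simpa using Real.log_natCast_nonneg n
  · exact Real.log_le_log (by exact_mod_cast hm) (by exact_mod_cast h)

theorem stripEntropy_ne_top [Finite A] (X : Subshift A) {u : Plane} (hu : ‖u‖ = 1) (r : ℝ) :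
    stripEntropy X u r ≠ ⊤ := by
  obtain ⟨c, hc⟩ := exists_card_latticePoints_le r
  have hlog := Real.log_natCast_nonneg (Nat.card A)
  refine ne_top_of_le_ne_top (ENNReal.ofReal_ne_top (r := c * 2 * Real.log (Nat.card A))) ?_
  refine limsup_le_of_le (h := ?_)
  filter_upwards [eventually_ge_atTop 1] with n hn
  refine ENNReal.ofReal_le_ofReal ?_
  obtain ⟨hfin, hcard⟩ := hc u hu n
  set S := latticePoints (Metric.thickening r ((n : ℝ) • segmentTo u)) with hS
  have := hfin.to_subtype
  have h1 : complexity X (Metric.thickening r ((n : ℝ) • segmentTo u)) ≤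
      Nat.card A ^ S.ncard := by
    rw [← Nat.card_coe_set_eq, ← Nat.card_fun, ← Set.ncard_univ]
    exact Set.ncard_le_ncard (Set.subset_univ _) (Set.toFinite _)
  have h2 := log_natCast_mono h1
  rw [Nat.cast_pow, Real.log_pow] at h2
  have hn' : (1 : ℝ) ≤ n := by exact_mod_cast hn
  rw [div_le_iff₀ (by linarith)]
  have h3 : (S.ncard : ℝ) ≤ c * (n + 1) := by exact_mod_cast hcard
  calc _ ≤ (S.ncard : ℝ) * Real.log (Nat.card A) := h2
    _ ≤ (c * 2 * n) * Real.log (Nat.card A) := by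
        refine mul_le_mul_of_nonneg_right (h3.trans ?_) hlog
        have : (0 : ℝ) ≤ c := by positivity
        nlinarith
    _ = _ := by ring

theorem stripEntropy_mono [Finite A] (X : Subshift A) {u : Plane} (hu : ‖u‖ = 1) :
    Monotone (stripEntropy X u) := by
  intro r s hrs
  obtain ⟨c, hc⟩ := exists_card_latticePoints_le s
  refine limsup_le_limsup (Eventually.of_forall fun n => ENNReal.ofReal_le_ofReal ?_)
  refine div_le_div_of_nonneg_right (log_natCast_mono ?_) (by positivity)
  refine complexity_le_of_codes 0 (codes_of_subset (Metric.thickening_mono hrs _)) (hc u hu n).1 ?_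
  simp

theorem stripEntropy_le_directionalEntropy [Finite A] (X : Subshift A) {u : Plane} (hu : ‖u‖ = 1)
    (r : ℝ) : stripEntropy X u r ≤ directionalEntropy X u := by
  rw [directionalEntropy_eq]
  refine le_limsup_of_frequently_le' (Eventually.frequently ?_)
  filter_upwards [eventually_ge_atTop r] with s hs using stripEntropy_mono X hu hs

theorem limsup_comp_le_of_tendsto {g : ℕ → ℕ} (hg : Tendsto g atTop atTop) (f : ℕ → ENNReal) :
    limsup (fun n => f (g n)) atTop ≤ limsup f atTop := by
  refine le_of_eq_of_le ?_ (limsup_le_limsup_of_le (f := map g atTop) hg)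
  exact limsup_comp f g atTop

/-- If the complexity of the strips along `v` is bounded by that of the `k` times longer strips of
width `r₀` along `u`, then the entropy in direction `v` is at most `k` times that of these strips. -/
theorem directionalEntropy_le_mul_stripEntropy (X : Subshift A) {u v : Plane} {k : ℕ} (hk : 0 < k)
    {r₀ : ℝ} (h : ∀ r : ℝ, ∀ᶠ n : ℕ in atTop,
      complexity X (Metric.thickening r ((n : ℝ) • segmentTo v)) ≤
        complexity X (Metric.thickening r₀ (((k * n : ℕ) : ℝ) • segmentTo u))) :
    directionalEntropy X v ≤ k * stripEntropy X u r₀ := by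
  rw [directionalEntropy_eq]
  refine limsup_le_of_le (h := Eventually.of_forall fun r => ?_)
  have htend : Tendsto (fun n => k * n) atTop atTop := tendsto_id.const_mul_atTop' hk
  have hk' : (k : ℝ) ≠ 0 := by exact_mod_cast hk.ne'
  have hrate : ∀ᶠ n : ℕ in atTop,
      stripRate X v r n ≤ k * stripRate X u r₀ (k * n) := by
    filter_upwards [h r] with n hn
    have hlog := div_le_div_of_nonneg_right (log_natCast_mono hn) (Nat.cast_nonneg (α := ℝ) n)
    rw [stripRate, stripRate, ← ENNReal.ofReal_natCast k, ← ENNReal.ofReal_mul (Nat.cast_nonneg k)]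
    refine ENNReal.ofReal_le_ofReal (hlog.trans_eq ?_)
    generalize Real.log _ = l
    rw [Nat.cast_mul k n, ← mul_div_assoc, mul_div_mul_left _ _ hk']
  calc stripEntropy X v r ≤ limsup (fun n => (k : ENNReal) * stripRate X u r₀ (k * n)) atTop :=
        limsup_le_limsup hrate
    _ = k * limsup (fun n => stripRate X u r₀ (k * n)) atTop :=
        ENNReal.limsup_const_mul_of_ne_top (ENNReal.natCast_ne_top k)
    _ ≤ k * limsup (stripRate X u r₀) atTop :=
        mul_le_mul_right (limsup_comp_le_of_tendsto htend _) _

/-- The width `r` on the left is absorbed once `n ≥ r + 1`, so a single width `r₀` bounds all of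
them; this gives finiteness. Vectors `v` of any length are allowed because nontriviality of the
seminorm supplies one of unknown length. -/
theorem exists_directionalEntropy_le {P : ConvexIntegerPolygon} (hP : P.NoAntiparallelSides) :
    ∃ (r₀ : ℝ) (K : ℝ → ℕ), (∀ x, 0 < K x) ∧
      ∀ (A : Type*) [Finite A] [TopologicalSpace A] (X : Subshift A),
      IsPolygonal X P → ∀ u v : Plane, ‖u‖ = 1 →
        directionalEntropy X v ≤ K ‖v‖ * stripEntropy X u r₀ := by
  obtain ⟨ρ, r₀, hρ, hle⟩ := exists_complexity_le hP
  refine ⟨r₀, fun x => ⌈(x + 1) / ρ⌉₊ + 1, fun x => Nat.succ_pos _, ?_⟩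
  intro A _ _ X hX u v hu
  refine directionalEntropy_le_mul_stripEntropy X (Nat.succ_pos _) fun r => ?_
  filter_upwards [tendsto_natCast_atTop_atTop.eventually_ge_atTop (r + 1)] with n hn
  refine hle A X hX u v hu r n _ ?_
  have h1 := Nat.le_ceil ((‖v‖ + 1) / ρ)
  rw [div_le_iff₀ hρ] at h1
  push_cast
  have h2 := mul_le_mul_of_nonneg_right h1 (Nat.cast_nonneg (α := ℝ) n)
  have h3 : 0 ≤ ρ * n := by positivity
  linarith

end PolygonalShift

theorem proposition6p9 (P : PolygonalShift.ConvexIntegerPolygon)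
    (hP : P.NoAntiparallelSides) :
    ∃ D : ℝ, 0 < D ∧
      ∀ (A : Type*) [Finite A] [TopologicalSpace A] [DiscreteTopology A]
        (X : PolygonalShift.Subshift A),
        PolygonalShift.IsPolygonal X P → PolygonalShift.HasNontrivialEntropyNorm X →
        (∀ v : PolygonalShift.Plane, ‖v‖ = 1 →
          PolygonalShift.directionalEntropy X v ≠ 0 ∧
            PolygonalShift.directionalEntropy X v ≠ ⊤) ∧
        ∀ u v : PolygonalShift.Plane, ‖u‖ = 1 → ‖v‖ = 1 →
          1 / D ≤ (PolygonalShift.directionalEntropy X u).toReal /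
              (PolygonalShift.directionalEntropy X v).toReal ∧
            (PolygonalShift.directionalEntropy X u).toReal /
              (PolygonalShift.directionalEntropy X v).toReal ≤ D := by
  obtain ⟨r₀, K, hK, hle⟩ := PolygonalShift.exists_directionalEntropy_le hP
  refine ⟨K 1, by exact_mod_cast hK 1, ?_⟩
  intro A _ _ _ X hX ⟨w, hw⟩
  have hle' : ∀ u v : PolygonalShift.Plane, ‖u‖ = 1 →
      PolygonalShift.directionalEntropy X v ≤
        K ‖v‖ * PolygonalShift.directionalEntropy X u := fun u v hu =>
    (hle A X hX u v hu).trans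
      (mul_le_mul_right (PolygonalShift.stripEntropy_le_directionalEntropy X hu r₀) _)
  have hne : ∀ v : PolygonalShift.Plane, ‖v‖ = 1 →
      PolygonalShift.directionalEntropy X v ≠ 0 ∧
        PolygonalShift.directionalEntropy X v ≠ ⊤ := by
    intro v hv
    -- Vanishing in one unit direction forces vanishing at `w`; finiteness comes from comparing `v`
    -- with its own strip of width `r₀`.
    refine ⟨fun h0 => hw ?_, ne_top_of_le_ne_top ?_ (hle A X hX v v hv)⟩
    · simpa [h0] using hle' v w hv
    · exact ENNReal.mul_ne_top (ENNReal.natCast_ne_top _)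
        (PolygonalShift.stripEntropy_ne_top X hv r₀)
  refine ⟨hne, fun u v hu hv => ?_⟩
  have hpos : ∀ v : PolygonalShift.Plane, ‖v‖ = 1 →
      0 < (PolygonalShift.directionalEntropy X v).toReal := fun v hv =>
    ENNReal.toReal_pos (hne v hv).1 (hne v hv).2
  have hreal : ∀ u v : PolygonalShift.Plane, ‖u‖ = 1 → ‖v‖ = 1 →
      (PolygonalShift.directionalEntropy X v).toReal ≤
        K 1 * (PolygonalShift.directionalEntropy X u).toReal := by
    intro u v hu hv
    have h := ENNReal.toReal_mono
      (ENNReal.mul_ne_top (ENNReal.natCast_ne_top _) (hne u hu).2) (hle' u v hu)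
    rwa [ENNReal.toReal_mul, ENNReal.toReal_natCast, hv] at h
  have hD : (0 : ℝ) < K 1 := by exact_mod_cast hK 1
  constructor
  · rw [div_le_div_iff₀ hD (hpos v hv), one_mul, mul_comm]
    exact hreal u v hu hv
  · rw [div_le_iff₀ (hpos v hv)]
    exact hreal v u hv hu
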